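/- A signed graph $\Gamma=(G,\sigma)$ consists of a finite simple graph $G=(V,E)$ and a map $\sigma:E\to\{+1,-1\}$. Its adjacency matrix $A(\Gamma)$ is the real matrix indexed by $V$ whose $(u,v)$ entry is $\sigma(uv)$ if $uv\in E$ and $0$ otherwise, and its nullity $\eta(\Gamma)$ is the multiplicity of $0$ as an eigenvalue of $A(\Gamma)$. The signed graph $\Gamma$ is balanced if for every cycle of $G$ the product of the signs of its edges is $+1$, and it is unicyclic if $G$ is connected and contains exactly one cycle. Theorem. Let $\Gamma$ be a unicyclic signed graph of order $n=|V|$. Then: (1) $\eta(\Gamma)=n-2$ if and only if $\Gamma$ is balanced and its underlying graph is the cycle $C_4$ on four vertices. (2) $\eta(\Gamma)=n-3$ if and only if the underlying graph of $\Gamma$ is the cycle $C_3$ on three vertices (with any signs). -/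

import Mathlib

/-- A signed graph on the vertex set `V`: a simple graph together with a sign `1` or `-1`
(a unit of `ℤ`) on each of its edges. -/
structure SignedGraph (V : Type*) where
  graph : SimpleGraph V
  sign : graph.edgeSet → ℤˣ

namespace SignedGraph

variable {V : Type*}

open Classical in
/-- The adjacency matrix: the `(i, j)` entry is the sign of the edge `ij`, and `0` if `i`, `j`
are not adjacent. -/
noncomputable def adjMatrix (Γ : SignedGraph V) : Matrix V V ℝ :=
  Matrix.of fun i j =>
    if h : Γ.graph.Adj i j then
      (((Γ.sign ⟨s(i, j), Γ.graph.mem_edgeSet.mpr h⟩ : ℤˣ) : ℤ) : ℝ)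
    else 0

/-- The nullity: the multiplicity of `0` as a root of the characteristic polynomial of the
adjacency matrix. -/
noncomputable def nullity [Fintype V] [DecidableEq V] (Γ : SignedGraph V) : ℕ :=
  Γ.adjMatrix.charpoly.rootMultiplicity 0

/-- The product of the signs of the edges traversed by a walk. A walk which is a cycle traverses
each of its edges exactly once, so for it this is the sign of the cycle. -/
def walkSign (Γ : SignedGraph V) {u v : V} (w : Γ.graph.Walk u v) : ℤˣ :=
  (w.darts.map fun d => Γ.sign ⟨d.edge, d.edge_mem⟩).prod

/-- All cycles are positive. -/
def Balanced (Γ : SignedGraph V) : Prop :=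
  ∀ (v : V) (w : Γ.graph.Walk v v), w.IsCycle → Γ.walkSign w = 1

/-- Connected, with exactly one cycle. Cycles are counted as subgraphs, so that the starting
point and the direction of traversal do not matter. -/
def Unicyclic (Γ : SignedGraph V) : Prop :=
  Γ.graph.Connected ∧
    ∃! C : Γ.graph.Subgraph,
      ∃ (v : V) (w : Γ.graph.Walk v v), w.IsCycle ∧ w.toSubgraph = C

/-- The underlying graph is a cycle of order `k` (used for `k ≥ 3`). -/
def IsCycleOfOrder (Γ : SignedGraph V) (k : ℕ) : Prop :=
  Nonempty (Γ.graph ≃g SimpleGraph.cycleGraph k)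

end SignedGraph

open SimpleGraph

/-! The adjacency matrix is symmetric, so nullity is order minus rank, and both parts concern rank
at most three. Then all principal minors of order four vanish. For disjoint edges `ab`, `cd` this
forces a second perfect matching on the four vertices, hence a 4-cycle (`square_of_rank_le_three`).
Uniqueness of the cycle forbids chords and leaving edges, so the graph is that 4-cycle, and its
vanishing minor makes it positive. Without disjoint edges, the cycle is a triangle and nothing is
attached to it. Conversely, the ranks of these two graphs are computed directly. -/

/-- For a real symmetric matrix, the multiplicity of `0` as a root of the characteristic polynomial
and the rank add up to the order. -/
theorem Matrix.IsHermitian.rootMultiplicity_zero_add_rank {V : Type*} [Fintype V] [DecidableEq V]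
    {A : Matrix V V ℝ} (hA : A.IsHermitian) :
    A.charpoly.rootMultiplicity 0 + A.rank = Fintype.card V := by
  rw [← Polynomial.count_roots, hA.roots_charpoly_eq_eigenvalues, hA.rank_eq_card_non_zero_eigs,
    Multiset.count_map, Fintype.card_subtype, ← Finset.card_univ,
    ← Finset.card_filter_add_card_filter_not (s := Finset.univ) (fun i => hA.eigenvalues i = 0)]
  congr 1
  simp only [RCLike.ofReal_real_eq_id, Function.comp_apply, id_eq, eq_comm (a := (0 : ℝ))]
  rfl

/-- A nonzero minor of order `k` bounds the rank from below. -/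
theorem Matrix.le_rank_of_det_submatrix_ne_zero {V : Type*} [Fintype V] {k : ℕ}
    (A : Matrix V V ℝ) (f : Fin k → V) (h : (A.submatrix f f).det ≠ 0) : k ≤ A.rank := by
  have h1 := Matrix.rank_of_isUnit _ ((Matrix.isUnit_iff_isUnit_det _).2 (isUnit_iff_ne_zero.2 h))
  rw [Fintype.card_fin] at h1
  exact h1 ▸ A.rank_submatrix_le f f

/-- The products `p * u`, `q * t`, `r * s` belong to the three perfect matchings of four vertices.
If one of them vanishes, the value is the square of the difference of the other two. -/
theorem Matrix.det_fin_four_of_symm (p q r s t u : ℝ) :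
    Matrix.det !![0, p, q, r; p, 0, s, t; q, s, 0, u; r, t, u, 0] =
      (p * u) ^ 2 + (q * t) ^ 2 + (r * s) ^ 2
        - 2 * ((p * u) * (q * t) + (p * u) * (r * s) + (q * t) * (r * s)) := by
  simp [Matrix.det_succ_row_zero, Fin.sum_univ_succ, Fin.succAbove]
  ring

/-! ### Short cycles in simple graphs -/

namespace SimpleGraph

variable {V : Type*} {G : SimpleGraph V}

theorem Connected.exists_adj_notMem (hG : G.Connected) {S : Set V} (hS : S.Nonempty)
    (hS' : S ≠ Set.univ) : ∃ a ∈ S, ∃ e ∉ S, G.Adj a e := by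
  obtain ⟨a, ha⟩ := hS
  obtain ⟨e, he⟩ := (Set.ne_univ_iff_exists_notMem S).1 hS'
  obtain ⟨w⟩ := hG a e
  obtain ⟨d, -, h1, h2⟩ := w.exists_boundary_dart S ha he
  exact ⟨_, h1, _, h2, d.adj⟩

theorem isCycle_triangle {a b c : V} (hab : G.Adj a b) (hbc : G.Adj b c) (hca : G.Adj c a) :
    (Walk.cons hab (.cons hbc (.cons hca .nil))).IsCycle := by
  have := hab.ne; have := hbc.ne; have := hca.ne
  simp [Walk.cons_isCycle_iff, Walk.cons_isPath_iff]
  grind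

theorem isCycle_square {a b c d : V} (hab : G.Adj a b) (hbc : G.Adj b c) (hcd : G.Adj c d)
    (hda : G.Adj d a) (hac : a ≠ c) (hbd : b ≠ d) :
    (Walk.cons hab (.cons hbc (.cons hcd (.cons hda .nil)))).IsCycle := by
  have := hab.ne; have := hbc.ne; have := hcd.ne; have := hda.ne
  simp [Walk.cons_isCycle_iff, Walk.cons_isPath_iff]
  grind

/-- A cycle starts with three edges that do not backtrack. -/
theorem Walk.IsCycle.exists_adj_adj_adj {v : V} {w : G.Walk v v} (hw : w.IsCycle) :
    ∃ b c d, G.Adj v b ∧ G.Adj b c ∧ G.Adj c d ∧ v ≠ c ∧ b ≠ d := by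
  match w, hw with
  | .nil, hw => exact absurd hw Walk.not_isCycle_nil
  | .cons h1 .nil, hw => exact absurd h1 (G.loopless.irrefl _)
  | .cons h1 (.cons h2 .nil), hw => simp [Walk.cons_isCycle_iff] at hw
  | .cons (v := b) h1 (.cons (v := c) h2 (.cons (v := d) h3 p)), hw =>
    refine ⟨b, c, d, h1, h2, h3, ?_, ?_⟩
    · rintro rfl
      simp [Walk.cons_isCycle_iff] at hw
    · rintro rfl
      simp [Walk.cons_isCycle_iff] at hw

end SimpleGraph

/-! ### Signs and adjacency entries -/

namespace SignedGraph

variable {V : Type*} (Γ : SignedGraph V)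

open Classical in
/-- The sign of an edge, extended by `1` to all unordered pairs. -/
noncomputable def edgeSign (e : Sym2 V) : ℤˣ :=
  if h : e ∈ Γ.graph.edgeSet then Γ.sign ⟨e, h⟩ else 1

theorem walkSign_eq_prod_edges {u v : V} (w : Γ.graph.Walk u v) :
    Γ.walkSign w = (w.edges.map Γ.edgeSign).prod := by
  rw [walkSign, Walk.edges, List.map_map]
  congr 1
  refine List.map_congr_left fun d _ => ?_
  rw [Function.comp_apply, edgeSign, dif_pos d.edge_mem]

/-- The sign of a cycle depends only on its subgraph. -/
theorem walkSign_eq_of_toSubgraph_eq {u v : V} {w : Γ.graph.Walk u u} {w' : Γ.graph.Walk v v}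
    (hw : w.IsCycle) (hw' : w'.IsCycle) (h : w.toSubgraph = w'.toSubgraph) :
    Γ.walkSign w = Γ.walkSign w' := by
  classical
  rw [walkSign_eq_prod_edges, walkSign_eq_prod_edges,
    ← List.prod_toFinset _ hw.edges_nodup, ← List.prod_toFinset _ hw'.edges_nodup]
  congr 1
  ext e
  rw [List.mem_toFinset, List.mem_toFinset, ← Walk.mem_edges_toSubgraph,
    ← Walk.mem_edges_toSubgraph, h]

variable {Γ}

theorem adjMatrix_of_adj {i j : V} (h : Γ.graph.Adj i j) :
    Γ.adjMatrix i j = ((Γ.edgeSign s(i, j) : ℤ) : ℝ) := by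
  simp [adjMatrix, edgeSign, h]

theorem adjMatrix_of_not_adj {i j : V} (h : ¬ Γ.graph.Adj i j) : Γ.adjMatrix i j = 0 := by
  simp [adjMatrix, h]

variable (Γ) in
theorem adjMatrix_symm (i j : V) : Γ.adjMatrix i j = Γ.adjMatrix j i := by
  by_cases h : Γ.graph.Adj i j
  · rw [adjMatrix_of_adj h, adjMatrix_of_adj h.symm, Sym2.eq_swap]
  · rw [adjMatrix_of_not_adj h, adjMatrix_of_not_adj (mt Adj.symm h)]

variable (Γ) in
theorem adjMatrix_self (i : V) : Γ.adjMatrix i i = 0 := adjMatrix_of_not_adj (by simp)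

theorem sq_adjMatrix_of_adj {i j : V} (h : Γ.graph.Adj i j) : Γ.adjMatrix i j ^ 2 = 1 := by
  rw [adjMatrix_of_adj h]
  rcases Int.units_eq_one_or (Γ.edgeSign s(i, j)) with h | h <;> simp [h]

theorem walkSign_square {a b c d : V} (hab : Γ.graph.Adj a b) (hbc : Γ.graph.Adj b c)
    (hcd : Γ.graph.Adj c d) (hda : Γ.graph.Adj d a) :
    ((Γ.walkSign (.cons hab (.cons hbc (.cons hcd (.cons hda .nil)))) : ℤ) : ℝ) =
      Γ.adjMatrix a b * (Γ.adjMatrix b c * (Γ.adjMatrix c d * Γ.adjMatrix d a)) := by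
  simp [walkSign_eq_prod_edges, adjMatrix_of_adj, hab, hbc, hcd, hda]

theorem nullity_add_rank [Fintype V] [DecidableEq V] :
    Γ.nullity + Γ.adjMatrix.rank = Fintype.card V :=
  Matrix.IsHermitian.rootMultiplicity_zero_add_rank
    (Matrix.IsHermitian.ext fun i j => Γ.adjMatrix_symm j i)

/-! ### Consequences of rank at most three -/

/-- If the rank is less than four, every principal minor of order four vanishes. -/
theorem minor_eq_zero_of_rank_le_three [Fintype V] (hr : Γ.adjMatrix.rank ≤ 3) (a b c d : V) :
    (Γ.adjMatrix a b * Γ.adjMatrix c d) ^ 2 + (Γ.adjMatrix a c * Γ.adjMatrix b d) ^ 2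
      + (Γ.adjMatrix a d * Γ.adjMatrix b c) ^ 2
      - 2 * ((Γ.adjMatrix a b * Γ.adjMatrix c d) * (Γ.adjMatrix a c * Γ.adjMatrix b d)
        + (Γ.adjMatrix a b * Γ.adjMatrix c d) * (Γ.adjMatrix a d * Γ.adjMatrix b c)
        + (Γ.adjMatrix a c * Γ.adjMatrix b d) * (Γ.adjMatrix a d * Γ.adjMatrix b c)) = 0 := by
  rw [← Matrix.det_fin_four_of_symm]
  by_contra h
  have : Γ.adjMatrix.submatrix ![a, b, c, d] ![a, b, c, d] =
      !![0, Γ.adjMatrix a b, Γ.adjMatrix a c, Γ.adjMatrix a d;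
        Γ.adjMatrix a b, 0, Γ.adjMatrix b c, Γ.adjMatrix b d;
        Γ.adjMatrix a c, Γ.adjMatrix b c, 0, Γ.adjMatrix c d;
        Γ.adjMatrix a d, Γ.adjMatrix b d, Γ.adjMatrix c d, 0] := by
    ext i j
    fin_cases i <;> fin_cases j <;> first | rfl | exact Γ.adjMatrix_self _ | exact Γ.adjMatrix_symm _ _
  rw [← this] at h
  exact absurd (Matrix.le_rank_of_det_submatrix_ne_zero _ _ h) (by omega)

/-- If the rank is less than four, two disjoint edges lie on a common 4-cycle. -/
theorem square_of_rank_le_three [Fintype V] (hr : Γ.adjMatrix.rank ≤ 3) {a b c d : V}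
    (hab : Γ.graph.Adj a b) (hcd : Γ.graph.Adj c d) :
    (Γ.graph.Adj b c ∧ Γ.graph.Adj d a) ∨ (Γ.graph.Adj a c ∧ Γ.graph.Adj b d) := by
  have h := minor_eq_zero_of_rank_le_three hr a b c d
  by_contra! h'
  have h1 : Γ.adjMatrix a c * Γ.adjMatrix b d = 0 := by
    by_cases hac : Γ.graph.Adj a c
    · rw [adjMatrix_of_not_adj (h'.2 hac), mul_zero]
    · rw [adjMatrix_of_not_adj hac, zero_mul]
  have h2 : Γ.adjMatrix a d * Γ.adjMatrix b c = 0 := by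
    by_cases hbc : Γ.graph.Adj b c
    · rw [adjMatrix_symm, adjMatrix_of_not_adj (h'.1 hbc), zero_mul]
    · rw [adjMatrix_of_not_adj hbc, mul_zero]
  rw [h1, h2, mul_pow, sq_adjMatrix_of_adj hab, sq_adjMatrix_of_adj hcd] at h
  norm_num at h

theorem Unicyclic.toSubgraph_eq (hΓ : Γ.Unicyclic) {u v : V} {w : Γ.graph.Walk u u}
    {w' : Γ.graph.Walk v v} (hw : w.IsCycle) (hw' : w'.IsCycle) :
    w.toSubgraph = w'.toSubgraph :=
  hΓ.2.unique ⟨u, w, hw, rfl⟩ ⟨v, w', hw', rfl⟩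

theorem Unicyclic.mem_support_iff (hΓ : Γ.Unicyclic) {u v : V} {w : Γ.graph.Walk u u}
    {w' : Γ.graph.Walk v v} (hw : w.IsCycle) (hw' : w'.IsCycle) (x : V) :
    x ∈ w.support ↔ x ∈ w'.support := by
  rw [← Walk.mem_verts_toSubgraph, ← Walk.mem_verts_toSubgraph, hΓ.toSubgraph_eq hw hw']

/-- In a unicyclic signed graph of rank less than four, no edge leaves a 4-cycle. -/
theorem Unicyclic.mem_square_of_adj [Fintype V] (hΓ : Γ.Unicyclic) (hr : Γ.adjMatrix.rank ≤ 3)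
    {a b c d e : V} (hab : Γ.graph.Adj a b) (hbc : Γ.graph.Adj b c) (hcd : Γ.graph.Adj c d)
    (hda : Γ.graph.Adj d a) (hac : a ≠ c) (hbd : b ≠ d) (hae : Γ.graph.Adj a e) :
    e = a ∨ e = b ∨ e = c ∨ e = d := by
  by_contra! he
  obtain ⟨hea, heb, hec, hed⟩ := he
  have hsq := isCycle_square hab hbc hcd hda hac hbd
  -- The edges `ae` and `bc` are disjoint, so they span a 4-cycle through `e`, a second cycle.
  rcases square_of_rank_le_three hr hae hbc with ⟨h1, h2⟩ | ⟨h1, h2⟩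
  · have := hΓ.mem_support_iff hsq (isCycle_square hae h1 hbc h2 hab.ne hec) e
    simp at this
    grind
  · have := hΓ.mem_support_iff hsq (isCycle_square hae h2 hbc.symm h1.symm hac heb) e
    simp at this
    grind

/-- In a unicyclic signed graph, a 4-cycle has no chord. -/
theorem Unicyclic.not_adj_of_square (hΓ : Γ.Unicyclic) {a b c d : V} (hab : Γ.graph.Adj a b)
    (hbc : Γ.graph.Adj b c) (hcd : Γ.graph.Adj c d) (hda : Γ.graph.Adj d a) (hbd : b ≠ d) :
    ¬ Γ.graph.Adj a c := by
  intro hac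
  -- A chord would give a triangle avoiding `d`.
  have hmem := hΓ.mem_support_iff (isCycle_square hab hbc hcd hda hac.ne hbd)
    (isCycle_triangle hab hbc hac.symm) d
  simp [hbd.symm, hcd.ne.symm, hda.ne] at hmem

theorem Unicyclic.of_square [Fintype V] (hΓ : Γ.Unicyclic) (hr : Γ.adjMatrix.rank ≤ 3)
    {a b c d : V} (hab : Γ.graph.Adj a b) (hbc : Γ.graph.Adj b c) (hcd : Γ.graph.Adj c d)
    (hda : Γ.graph.Adj d a) (hac : a ≠ c) (hbd : b ≠ d) :
    Γ.IsCycleOfOrder 4 ∧ Γ.Balanced := by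
  have nac := hΓ.not_adj_of_square hab hbc hcd hda hbd
  have nbd := hΓ.not_adj_of_square hbc hcd hda hab hac.symm
  have huniv : ({a, b, c, d} : Set V) = Set.univ := by
    by_contra hne
    obtain ⟨x, hx, e, he, hxe⟩ := hΓ.1.exists_adj_notMem ⟨a, by simp⟩ hne
    simp only [Set.mem_insert_iff, Set.mem_singleton_iff] at hx he
    rcases hx with rfl | rfl | rfl | rfl
    · have := hΓ.mem_square_of_adj hr hab hbc hcd hda hac hbd hxe; tauto
    · have := hΓ.mem_square_of_adj hr hbc hcd hda hab hbd hac.symm hxe; tauto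
    · have := hΓ.mem_square_of_adj hr hcd hda hab hbc hac.symm hbd.symm hxe; tauto
    · have := hΓ.mem_square_of_adj hr hda hab hbc hcd hbd.symm hac hxe; tauto
  refine ⟨?_, ?_⟩
  · have hbij : Function.Bijective ![a, b, c, d] := by
      constructor
      · have := hab.ne; have := hbc.ne; have := hcd.ne; have := hda.ne
        intro i j hij
        fin_cases i <;> fin_cases j <;> simp at hij ⊢ <;> grind
      · intro x
        have hx : x ∈ ({a, b, c, d} : Set V) := huniv ▸ Set.mem_univ x
        rcases hx with rfl | rfl | rfl | rfl
        exacts [⟨0, rfl⟩, ⟨1, rfl⟩, ⟨2, rfl⟩, ⟨3, rfl⟩]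
    refine ⟨(RelIso.mk (Equiv.ofBijective _ hbij) ?_ : cycleGraph 4 ≃g Γ.graph).symm⟩
    intro i j
    fin_cases i <;> fin_cases j <;>
      simp [cycleGraph_adj, hab, hbc, hcd, hda, nac, nbd, hab.symm, hbc.symm, hcd.symm, hda.symm,
        mt Adj.symm nac, mt Adj.symm nbd] <;> decide
  · intro v w hw
    have hsq := isCycle_square hab hbc hcd hda hac hbd
    rw [Γ.walkSign_eq_of_toSubgraph_eq hw hsq (hΓ.toSubgraph_eq hw hsq)]
    have h := minor_eq_zero_of_rank_le_three hr a b c d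
    rw [adjMatrix_of_not_adj nac, Γ.adjMatrix_symm a d] at h
    have hs := walkSign_square hab hbc hcd hda
    have h1 : ((Γ.walkSign (.cons hab (.cons hbc (.cons hcd (.cons hda .nil)))) : ℤ) : ℝ) = 1 := by
      rw [hs]
      -- With no chord `ac`, the minor is `(x - y) ^ 2` for the two matching products of the square.
      -- So `x = y`, and the sign is `x * y = x ^ 2 = 1`.
      nlinarith [mul_pow (Γ.adjMatrix a b) (Γ.adjMatrix c d) 2, sq_adjMatrix_of_adj hab,
        sq_adjMatrix_of_adj hbc, sq_adjMatrix_of_adj hcd, sq_adjMatrix_of_adj hda,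
        mul_pow (Γ.adjMatrix d a) (Γ.adjMatrix b c) 2]
    exact Units.val_eq_one.1 (Int.cast_eq_one.1 h1)

theorem Unicyclic.of_rank_le_three [Fintype V] (hΓ : Γ.Unicyclic) (hr : Γ.adjMatrix.rank ≤ 3) :
    Γ.IsCycleOfOrder 3 ∨ (Γ.IsCycleOfOrder 4 ∧ Γ.Balanced) := by
  by_cases hdisj : ∃ a b c d, Γ.graph.Adj a b ∧ Γ.graph.Adj c d ∧ a ≠ c ∧ a ≠ d ∧ b ≠ c ∧ b ≠ d
  · obtain ⟨a, b, c, d, hab, hcd, hac, had, hbc, hbd⟩ := hdisj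
    right
    rcases square_of_rank_le_three hr hab hcd with ⟨h1, h2⟩ | ⟨h1, h2⟩
    · exact hΓ.of_square hr hab h1 hcd h2 hac hbd
    · exact hΓ.of_square hr hab h2 hcd.symm h1.symm had hbc
  · left
    push Not at hdisj
    obtain ⟨C, ⟨a, w, hw, -⟩, -⟩ := hΓ.2
    obtain ⟨b, c, d, hab, hbc, hcd, hac, hbd⟩ := hw.exists_adj_adj_adj
    -- Otherwise `ab` and `cd` would be disjoint edges.
    obtain rfl : a = d := by
      by_contra had
      exact hbd (hdisj a b c d hab hcd hac had hbc.ne)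
    have huniv : ({a, b, c} : Set V) = Set.univ := by
      by_contra hne
      obtain ⟨x, hx, e, he, hxe⟩ := hΓ.1.exists_adj_notMem ⟨a, by simp⟩ hne
      simp only [Set.mem_insert_iff, Set.mem_singleton_iff] at hx he
      have := hab.ne; have := hbc.ne; have := hcd.ne
      -- An edge leaving the triangle is disjoint from the side opposite its endpoint.
      rcases hx with rfl | rfl | rfl
      · have := hdisj _ _ _ _ hxe hbc; grind
      · have := hdisj _ _ _ _ hxe hcd; grind
      · have := hdisj _ _ _ _ hxe hab; grind
    have hbij : Function.Bijective ![a, b, c] := by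
      constructor
      · have := hab.ne; have := hbc.ne; have := hcd.ne
        intro i j hij
        fin_cases i <;> fin_cases j <;> simp at hij ⊢ <;> grind
      · intro x
        have hx : x ∈ ({a, b, c} : Set V) := huniv ▸ Set.mem_univ x
        rcases hx with rfl | rfl | rfl
        exacts [⟨0, rfl⟩, ⟨1, rfl⟩, ⟨2, rfl⟩]
    refine ⟨(RelIso.mk (Equiv.ofBijective _ hbij) ?_ : cycleGraph 3 ≃g Γ.graph).symm⟩
    intro i j
    fin_cases i <;> fin_cases j <;>
      simp [cycleGraph_adj, hab, hbc, hcd, hab.symm, hbc.symm, hcd.symm] <;> decide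

/-! ### Ranks of the two cycles -/

theorem IsCycleOfOrder.rank_three [Fintype V] (h : Γ.IsCycleOfOrder 3) :
    Γ.adjMatrix.rank = 3 := by
  obtain ⟨f⟩ := h
  have hadj (i j : Fin 3) (hij : (cycleGraph 3).Adj i j) : Γ.graph.Adj (f.symm i) (f.symm j) :=
    f.symm.map_adj_iff.2 hij
  have hcard : Fintype.card V = 3 := by simpa using Fintype.card_congr f.toEquiv
  refine le_antisymm (hcard ▸ Γ.adjMatrix.rank_le_card_width)
    (Matrix.le_rank_of_det_submatrix_ne_zero _ f.symm ?_)
  have h01 := sq_adjMatrix_of_adj (hadj 0 1 (by rw [cycleGraph_adj]; decide))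
  have h12 := sq_adjMatrix_of_adj (hadj 1 2 (by rw [cycleGraph_adj]; decide))
  have h20 := sq_adjMatrix_of_adj (hadj 2 0 (by rw [cycleGraph_adj]; decide))
  rw [Matrix.det_fin_three]
  simp only [Matrix.submatrix_apply, adjMatrix_self, Γ.adjMatrix_symm (f.symm 1) (f.symm 0),
    Γ.adjMatrix_symm (f.symm 2) (f.symm 1), Γ.adjMatrix_symm (f.symm 0) (f.symm 2)]
  -- The determinant is twice the product of the three signs.
  intro h
  grind

theorem IsCycleOfOrder.rank_four [Fintype V] (h : Γ.IsCycleOfOrder 4) (hb : Γ.Balanced) :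
    Γ.adjMatrix.rank = 2 := by
  obtain ⟨f⟩ := h
  have hadj (i j : Fin 4) : Γ.graph.Adj (f.symm i) (f.symm j) ↔ (cycleGraph 4).Adj i j :=
    f.symm.map_adj_iff
  have h01 := (hadj 0 1).2 (by rw [cycleGraph_adj]; decide)
  have h12 := (hadj 1 2).2 (by rw [cycleGraph_adj]; decide)
  have h23 := (hadj 2 3).2 (by rw [cycleGraph_adj]; decide)
  have h30 := (hadj 3 0).2 (by rw [cycleGraph_adj]; decide)
  have n02 := mt (hadj 0 2).1 (by rw [cycleGraph_adj]; decide)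
  have n13 := mt (hadj 1 3).1 (by rw [cycleGraph_adj]; decide)
  have hs := walkSign_square h01 h12 h23 h30
  rw [hb _ _ (isCycle_square h01 h12 h23 h30 (by simp) (by simp))] at hs
  rw [← Γ.adjMatrix.rank_submatrix f.symm.toEquiv f.symm.toEquiv]
  obtain ⟨p, hp⟩ : ∃ p, p = Γ.adjMatrix (f.symm 0) (f.symm 1) := ⟨_, rfl⟩
  obtain ⟨q, hq⟩ : ∃ q, q = Γ.adjMatrix (f.symm 1) (f.symm 2) := ⟨_, rfl⟩
  obtain ⟨r, hr⟩ : ∃ r, r = Γ.adjMatrix (f.symm 2) (f.symm 3) := ⟨_, rfl⟩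
  obtain ⟨s, hs'⟩ : ∃ s, s = Γ.adjMatrix (f.symm 3) (f.symm 0) := ⟨_, rfl⟩
  have hp2 := sq_adjMatrix_of_adj h01
  have hq2 := sq_adjMatrix_of_adj h12
  have hr2 := sq_adjMatrix_of_adj h23
  have hs2 := sq_adjMatrix_of_adj h30
  have hM : Γ.adjMatrix.submatrix f.symm.toEquiv f.symm.toEquiv =
      !![0, p, 0, s; p, 0, q, 0; 0, q, 0, r; s, 0, r, 0] := by
    rw [hp, hq, hr, hs']
    ext i j
    fin_cases i <;> fin_cases j <;>
      first
      | rfl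
      | exact Γ.adjMatrix_self _
      | exact Γ.adjMatrix_symm _ _
      | exact adjMatrix_of_not_adj n02
      | exact adjMatrix_of_not_adj n13
      | exact adjMatrix_of_not_adj (mt Adj.symm n02)
      | exact adjMatrix_of_not_adj (mt Adj.symm n13)
  rw [← hp, ← hq, ← hr, ← hs'] at hs
  rw [← hp] at hp2
  rw [← hq] at hq2
  rw [← hr] at hr2
  rw [← hs'] at hs2
  have hprod : p * (q * (r * s)) = 1 := by rw [← hs]; norm_num
  rw [hM]
  apply le_antisymm
  -- Since `p * q * r * s = 1` and all squares are 1, row 2 is `p * q` times row 0 and row 3 is `p *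
  -- s` times row 1.
  · have hfac : !![0, p, 0, s; p, 0, q, 0; 0, q, 0, r; s, 0, r, 0] =
        !![1, 0; 0, 1; p * q, 0; 0, p * s] * !![0, p, 0, s; p, 0, q, 0] := by
      ext i j
      fin_cases i <;> fin_cases j <;> simp [Matrix.mul_apply, Fin.sum_univ_two] <;> grind
    rw [hfac]
    exact (Matrix.rank_mul_le_left _ _).trans (Matrix.rank_le_width _)
  · refine Matrix.le_rank_of_det_submatrix_ne_zero _ ![0, 1] ?_
    rw [Matrix.det_fin_two]
    simp
    rintro rfl
    norm_num at hp2

end SignedGraph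

theorem mainTheorem1 {V : Type*} [Fintype V] [DecidableEq V] (Γ : SignedGraph V)
    (hΓ : Γ.Unicyclic) (n : ℕ) (hn : Fintype.card V = n) :
    ((Γ.nullity : ℤ) = (n : ℤ) - 2 ↔ Γ.IsCycleOfOrder 4 ∧ Γ.Balanced) ∧
    ((Γ.nullity : ℤ) = (n : ℤ) - 3 ↔ Γ.IsCycleOfOrder 3) := by
  have hrank := Γ.nullity_add_rank
  refine ⟨⟨fun h => ?_, fun h => ?_⟩, fun h => ?_, fun h => ?_⟩
  · refine (hΓ.of_rank_le_three (by omega)).resolve_left fun h3 => ?_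
    have := h3.rank_three
    omega
  · have := h.1.rank_four h.2
    omega
  · refine (hΓ.of_rank_le_three (by omega)).resolve_right fun h4 => ?_
    have := h4.1.rank_four h4.2
    omega
  · have := h.rank_three
    omega
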